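/- Let $\Sigma$ be a finite alphabet. Languages are sets of nonempty words over $\Sigma$. \emph{Real-time cellular automata.} A two-way cellular automaton $\mathcal A$ over $\Sigma$ consists of a finite set of states $Q\supset\Sigma$, a border state $\sharp\in Q\setminus\Sigma$, a set $Q_{accept}\subseteq Q$ of accepting states and a transition function $\delta:Q^3\to Q$ (neighborhood $\{-1,0,1\}$). On an input word $w=w_1\dots w_n$, $n\ge 1$, the state $\langle c,t\rangle$ of cell $c\in\mathbb Z$ at time $t\ge 1$ is given by: $\langle c,t\rangle=\sharp$ for all $t$ if $c\notin[1,n]$; $\langle c,1\rangle=w_c$ if $c\in[1,n]$ (parallel input); and $\langle c,t\rangle=\delta(\langle c-1,t-1\rangle,\langle c,t-1\rangle,\langle c+1,t-1\rangle)$ if $c\in[1,n]$ and $t>1$. The word $w$ is accepted in real time if $\langle 1,n\rangle\in Q_{accept}$ (the output cell is the first cell). $\mathtt{RealTime_{CA}}$ is the class of languages over $\Sigma$ that are the set of all nonempty words accepted in real time by some such automaton. \emph{Predecessor Horn formulas.} A nonempty word $w=w_1\dots w_n$ is encoded by the structure $\langle w\rangle$ with domain $[1,n]=\{1,\dots,n\}$,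 unary predicates $Q_s$ ($s\in\Sigma$), $\mathtt{min}$, $\mathtt{max}$ with $Q_s(i)\iff w_i=s$, $\mathtt{min}(i)\iff i=1$, $\mathtt{max}(i)\iff i=n$, and the predecessor function $\mathtt{pred}(i)=i-1$ for $i>1$, $\mathtt{pred}(1)=1$. For an integer $a\ge0$, $x-a$ denotes the term $\mathtt{pred}^a(x)$. A predecessor Horn formula is a formula $\Phi=\exists\mathbf R\,\forall x\,\forall y\,\psi(x,y)$, where $\mathbf R$ is a finite set of binary predicates and $\psi$ is a finite conjunction of clauses $\delta_1\wedge\dots\wedge\delta_r\to\delta_0$ ($r\ge 0$) such that $\delta_0$ is either $R(x,y)$ with $R\in\mathbf R$ or $\bot$ (false), and each hypothesis $\delta_i$ ($1\le i\le r$) has one of the following forms, with integers $a,b\ge 0$: $Q_s(x-a)$ or $Q_s(y-a)$ for $s\in\Sigma$; $U(x-a)$, $\neg U(x-a)$, $U(y-a)$ or $\neg U(y-a)$ for $U\in\{\mathtt{min},\mathtt{max}\}$; $S(x-a,y-b)$ or $S(y-b,x-a)$ for $S\in\mathbf R$. The formula $\Phi$ defines the language of all nonempty words $w$ over $\Sigma$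 such that $\langle w\rangle\models\Phi$, and $\mathtt{pred}\text{-}\mathtt{ESO}\text{-}\mathtt{HORN}$ is the class of languages over $\Sigma$ defined by predecessor Horn formulas. \textbf{Theorem.} $\mathtt{RealTime_{CA}}=\mathtt{pred}\text{-}\mathtt{ESO}\text{-}\mathtt{HORN}$. -/

import Mathlib

/-! ## One-dimensional cellular automata -/

/-- A one-dimensional cellular automaton with input alphabet `α` and neighborhood `N`:
a finite set `Q` of states containing the input alphabet and the permanent border state `♯`,
a set of accepting states, and a transition function giving the next state of a cell `c`
from the current states of the cells `c + v`, `v ∈ N`. -/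
structure CellularAutomaton (α : Type*) (N : Finset ℤ) where
  Q : Type
  finite_Q : Finite Q
  letter : α ↪ Q
  sharp : Q
  sharp_ne_letter : ∀ s : α, sharp ≠ letter s
  accept : Set Q
  δ : ((v : ℤ) → v ∈ N → Q) → Q

namespace CellularAutomaton

variable {α : Type*} {N : Finset ℤ}

/-- The state of cell `c` at time `k + 1` (that is, after `k` steps) on the word `w = w₁ … wₙ` with
parallel input: cell `i ∈ [1,n]` holds `wᵢ` at time `1`, and all the cells outside `[1,n]` are
permanently in state `♯`. -/
def stateAfter (A : CellularAutomaton α N) (w : List α) : ℕ → ℤ → A.Q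
  | 0, c =>
    if h : 1 ≤ c ∧ c ≤ (w.length : ℤ) then
      A.letter (w.get ⟨(c - 1).toNat, by omega⟩)
    else A.sharp
  | k + 1, c =>
    if 1 ≤ c ∧ c ≤ (w.length : ℤ) then
      A.δ (fun v _ => A.stateAfter w k (c + v))
    else A.sharp

/-- The language accepted in real time with parallel input, output cell `1` and neighborhood
`{-1, 0, 1}`: the nonempty words `w` of length `n` such that cell `1` is in an accepting state
at time `n`, i.e. after `n - 1` steps (the first instant at which it has received every letter). -/
def realTimeLanguage (A : CellularAutomaton α {-1, 0, 1}) : Language α :=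
  {w | w ≠ [] ∧ A.stateAfter w (w.length - 1) 1 ∈ A.accept}

end CellularAutomaton

/-- The class `RealTime_CA` of languages over `α`. -/
def RealTimeCA (α : Type*) : Set (Language α) :=
  {L | ∃ A : CellularAutomaton α {-1, 0, 1}, A.realTimeLanguage = L}

/-! ## Predecessor Horn formulas -/

namespace PredHorn

/-- The two first-order variables. -/
inductive Var
  | x
  | y

/-- The input predicates `min` and `max`. -/
inductive Extremum
  | min
  | max

/-- The hypotheses allowed in a clause, over the alphabet `α` and the set `ρ` of (binary)
computation predicates. -/
inductive Hypothesis (α : Type*) (ρ : Type)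
  /-- `Q_s(v - a)` -/
  | letter (s : α) (v : Var) (a : ℕ)
  /-- `U(v - a)` -/
  | pos (U : Extremum) (v : Var) (a : ℕ)
  /-- `¬ U(v - a)` -/
  | neg (U : Extremum) (v : Var) (a : ℕ)
  /-- `S(x - a, y - b)` -/
  | compXY (S : ρ) (a b : ℕ)
  /-- `S(y - b, x - a)` -/
  | compYX (S : ρ) (b a : ℕ)

/-- A Horn clause `δ₁ ∧ … ∧ δᵣ → δ₀`; the conclusion `δ₀` is `R(x,y)` for `some R` and `⊥` for
`none`. -/
structure Clause (α : Type*) (ρ : Type) where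
  hyps : List (Hypothesis α ρ)
  concl : Option ρ

/-- A predecessor Horn formula `∃ 𝐑 ∀ x ∀ y ψ(x,y)`, where `𝐑` is a finite set of binary
predicates, and `ψ` is a (finite) conjunction of Horn clauses. -/
structure Formula (α : Type*) where
  ρ : Type
  finite_ρ : Finite ρ
  clauses : List (Clause α ρ)

variable {α : Type*} {ρ : Type}

/-! The word `w = w₁ … wₙ` is encoded by a structure with domain `[1,n]`. The domain is represented
by `Fin w.length`, where `i : Fin w.length` stands for the position `i + 1`. -/

/-- The function `pred` of the word structure: `pred(i) = i - 1` for `i > 1`, and `pred(1) = 1`. -/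
def pred {n : ℕ} (i : Fin n) : Fin n :=
  ⟨i.val - 1, by omega⟩

/-- The interpretation of `min` and `max` in the word structure. -/
def Extremum.Holds {n : ℕ} : Extremum → Fin n → Prop
  | .min, i => i.val + 1 = 1
  | .max, i => i.val + 1 = n

/-- The value of a variable when `x = i` and `y = j`. -/
def Var.value {n : ℕ} (i j : Fin n) : Var → Fin n
  | .x => i
  | .y => j

/-- Truth of a hypothesis in the structure of `w` expanded by the relations `R`, when `x = i` and
`y = j`; the term `v - a` denotes `predᵃ(v)`. -/
def Hypothesis.Holds (w : List α) (R : ρ → Fin w.length → Fin w.length → Prop)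
    (i j : Fin w.length) : Hypothesis α ρ → Prop
  | .letter s v a => w.get (pred^[a] (v.value i j)) = s
  | .pos U v a => U.Holds (pred^[a] (v.value i j))
  | .neg U v a => ¬ U.Holds (pred^[a] (v.value i j))
  | .compXY S a b => R S (pred^[a] i) (pred^[b] j)
  | .compYX S b a => R S (pred^[b] j) (pred^[a] i)

/-- Truth of a clause when `x = i` and `y = j`. -/
def Clause.Holds (C : Clause α ρ) (w : List α) (R : ρ → Fin w.length → Fin w.length → Prop)
    (i j : Fin w.length) : Prop :=
  (∀ h ∈ C.hyps, h.Holds w R i j) →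
    match C.concl with
    | some S => R S i j
    | none => False

/-- The structure of the word `w` satisfies `∃ 𝐑 ∀ x ∀ y ψ(x,y)`. -/
def Formula.Sat (Φ : Formula α) (w : List α) : Prop :=
  ∃ R : Φ.ρ → Fin w.length → Fin w.length → Prop,
    ∀ i j : Fin w.length, ∀ C ∈ Φ.clauses, C.Holds w R i j

/-- The language (of nonempty words) defined by a formula. -/
def Formula.language (Φ : Formula α) : Language α :=
  {w | w ≠ [] ∧ Φ.Sat w}

end PredHorn

/-- The class `pred-ESO-HORN` of languages over `α`. -/
def PredESOHorn (α : Type*) : Set (Language α) :=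
  {L | ∃ Φ : PredHorn.Formula α, Φ.language = L}

/-! From automata to formulas, the state of the cell of index `j - i` after `i` steps is attached to
the pair `(i, j)`; the three states that determine it are then attached to pairs of predecessors,
and the output of the automaton to the last pair of positions.

Conversely, a Horn formula holds if and only if falsity is not derivable, that is, does not belong
to the least fixed point of the operator of immediate consequence. As this operator only looks a
bounded number of predecessors back, the least fixed point at `(x, y)` and `(y, x)` is a function of
the labels and of the least fixed point in a bounded window below `(x, y)`. The content of this
window can therefore be computed from the windows at `(x - 1, y)` and `(x, y - 1)`, or from the one
at `(y - 1, y)` alone when `x = y`, since the window at `(y, y - 1)` is its mirror image. The two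
windows are held by adjacent cells of an automaton in which the first cell treats the diagonal, and
`(n, n)` is treated in real time. The predicate `max` is the only one that sees the end of the word,
so the automaton keeps both the window for which `y` is the last position and the one for which it
is not. -/

/-! ## Real-time automata from finite tables -/

namespace CellularAutomaton

variable {α : Type*}

theorem stateAfter_zero_left {N : Finset ℤ} (A : CellularAutomaton α N) (w : List α) (k : ℕ) :
    A.stateAfter w k 0 = A.sharp := by
  cases k <;> simp [stateAfter]

section Table

variable {Q : Type*} [Finite Q]

/-- The automaton given by a transition table on `Q`. The left neighbor is `none` for the first
cell; a missing right neighbor may be treated arbitrarily, as the right border does not reach the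
first cell in real time. The states are brought to `Type` by `equivShrink`. -/
noncomputable def ofTable (letter : α ↪ Q) (step : Option Q → Q → Q → Q) (acc : Set Q) :
    CellularAutomaton α {-1, 0, 1} where
  Q := Shrink.{0} (Option Q)
  finite_Q := inferInstance
  letter := (letter.trans .some).trans (equivShrink.{0} (Option Q)).toEmbedding
  sharp := equivShrink.{0} _ none
  sharp_ne_letter _ h := Option.some_ne_none _ ((equivShrink.{0} (Option Q)).injective h).symm
  accept := {q | ∃ s ∈ acc, (equivShrink.{0} (Option Q)).symm q = some s}
  δ u :=
    let state (v : ℤ) (hv : v ∈ ({-1, 0, 1} : Finset ℤ)) : Option Q :=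
      (equivShrink.{0} (Option Q)).symm (u v hv)
    equivShrink.{0} _ ((state 0 (by simp)).bind fun m =>
      (state 1 (by simp)).map fun r => step (state (-1) (by simp)) m r)

section OfTable

variable (letter : α ↪ Q) (step : Option Q → Q → Q → Q) (acc : Set Q)

/-- The state in `Q` of a cell of `ofTable letter step acc`, where `none` is the border. -/
noncomputable def tableState : (ofTable letter step acc).Q → Option Q :=
  (equivShrink.{0} (Option Q)).symm

theorem tableState_sharp : tableState letter step acc (ofTable letter step acc).sharp = none :=
  (equivShrink.{0} (Option Q)).symm_apply_apply none

theorem tableState_letter (s : α) :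
    tableState letter step acc ((ofTable letter step acc).letter s) = some (letter s) :=
  (equivShrink.{0} (Option Q)).symm_apply_apply _

theorem tableState_δ {u : (v : ℤ) → v ∈ ({-1, 0, 1} : Finset ℤ) → (ofTable letter step acc).Q}
    {m r : Q} (hm : tableState letter step acc (u 0 (by simp)) = some m)
    (hr : tableState letter step acc (u 1 (by simp)) = some r) :
    tableState letter step acc ((ofTable letter step acc).δ u) =
      some (step (tableState letter step acc (u (-1) (by simp))) m r) := by
  simp only [tableState, ofTable, Equiv.symm_apply_apply] at hm hr ⊢
  simp only [hm, hr, Option.bind_some, Option.map_some]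

theorem tableState_stateAfter {w : List α} {st : ℕ → ℕ → Q}
    (hinit : ∀ c (h : c < w.length), st 0 c = letter w[c])
    (hborder : ∀ k, st (k + 1) 0 = step none (st k 0) (st k 1))
    (hinterior : ∀ k c,
      st (k + 1) (c + 1) = step (some (st k c)) (st k (c + 1)) (st k (c + 2)))
    (k c : ℕ) (h : c + k < w.length) :
    tableState letter step acc ((ofTable letter step acc).stateAfter w k (c + 1)) =
      some (st k c) := by
  induction k generalizing c with
  | zero =>
    rw [hinit c h, stateAfter, dif_pos (by omega), tableState_letter]
    simp
  | succ k ih =>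
    have hmiddle := ih c (by omega)
    have hright := ih (c + 1) (by omega)
    rw [← add_zero (c + 1 : ℤ)] at hmiddle
    rw [Nat.cast_succ] at hright
    rw [stateAfter, if_pos (by omega), tableState_δ _ _ _ hmiddle hright]
    cases c with
    | zero => simp [stateAfter_zero_left, tableState_sharp, hborder]
    | succ c => simp [ih c (by omega), hinterior]

end OfTable

theorem mem_realTimeCA_of_determined {st : List α → ℕ → ℕ → Q} (letter : α ↪ Q)
    (hinit : ∀ w c (h : c < w.length), st w 0 c = letter w[c])
    (hborder : ∀ {w w' k k'}, st w k 0 = st w' k' 0 → st w k 1 = st w' k' 1 →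
      st w (k + 1) 0 = st w' (k' + 1) 0)
    (hinterior : ∀ {w w' k k' c c'}, st w k c = st w' k' c' →
      st w k (c + 1) = st w' k' (c' + 1) → st w k (c + 2) = st w' k' (c' + 2) →
      st w (k + 1) (c + 1) = st w' (k' + 1) (c' + 1)) (acc : Set Q) :
    ({w | w ≠ [] ∧ st w (w.length - 1) 0 ∈ acc} : Language α) ∈ RealTimeCA α := by
  have : Nonempty Q := ⟨st [] 0 0⟩
  obtain ⟨border, hborder⟩ := (Function.factorsThrough_iff
      (f := fun i : List α × ℕ => (st i.1 i.2 0, st i.1 i.2 1)) (fun i => st i.1 (i.2 + 1) 0)).1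
    fun i i' h => hborder (Prod.ext_iff.1 h).1 (Prod.ext_iff.1 h).2
  obtain ⟨interior, hinterior⟩ := (Function.factorsThrough_iff
      (f := fun i : List α × ℕ × ℕ =>
        (st i.1 i.2.1 i.2.2, st i.1 i.2.1 (i.2.2 + 1), st i.1 i.2.1 (i.2.2 + 2)))
      (fun i => st i.1 (i.2.1 + 1) (i.2.2 + 1))).1
    fun i i' h => by simp only [Prod.mk.injEq] at h; exact hinterior h.1 h.2.1 h.2.2
  let step (l : Option Q) (m r : Q) : Q := l.elim (border (m, r)) fun l => interior (l, m, r)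
  refine ⟨ofTable letter step acc, Set.ext fun w => and_congr_right fun hw => ?_⟩
  have hfirst := tableState_stateAfter letter step acc (hinit w)
    (fun k => congrFun hborder (w, k)) (fun k c => congrFun hinterior (w, k, c))
    (w.length - 1) 0 (by have := List.length_pos_iff.2 hw; omega)
  rw [Nat.cast_zero, zero_add] at hfirst
  exact ⟨fun ⟨s, hs, h⟩ => Option.some.inj (hfirst.symm.trans h) ▸ hs, fun h => ⟨_, h, hfirst⟩⟩

end Table

/-- The values `H p x y`, `x ≤ y + 1`, of each instance `p` of the recurrence can be filled in from
row `x = 0` by a common finite table: the value at `(x + 1, y + 1)` is read off those at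
`(x, y + 1)` and `(x + 1, y)`, and the one at `(y + 1, y)` off the one at `(y, y)`. The table is
encoded by the equalities that make it exist. -/
structure IsTriangular {ι T : Type*} (H : ι → ℕ → ℕ → T) : Prop where
  zero_iff : ∀ {p p' x x' y y'}, H p x y = H p' x' y' → (x = 0 ↔ x' = 0)
  diag : ∀ {p p' y y'}, H p y y = H p' y' y' → H p (y + 1) y = H p' (y' + 1) y'
  inner : ∀ {p p' x x' y y'}, x ≤ y → x' ≤ y' → H p x (y + 1) = H p' x' (y' + 1) →
    H p (x + 1) y = H p' (x' + 1) y' → H p (x + 1) (y + 1) = H p' (x' + 1) (y' + 1)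

namespace IsTriangular

variable {ι T : Type*} {H : ι → ℕ → ℕ → T} {p p' : ι} {x x' y y' : ℕ}

theorem right (hH : IsTriangular H) (hxy : x ≤ y + 1) (hxy' : x' ≤ y' + 1)
    (hup : H p (x - 1) (y + 1) = H p' (x' - 1) (y' + 1)) (hleft : H p x y = H p' x' y') :
    H p x (y + 1) = H p' x' (y' + 1) := by
  cases x with
  | zero =>
    obtain rfl := (hH.zero_iff hleft).1 rfl
    exact hup
  | succ x =>
    obtain ⟨x', rfl⟩ := Nat.exists_eq_succ_of_ne_zero
      (mt (hH.zero_iff hleft).2 x.succ_ne_zero)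
    exact hH.inner (by omega) (by omega) hup hleft

theorem right_right (hH : IsTriangular H) (hxy : x ≤ y + 1) (hxy' : x' ≤ y' + 1)
    (hup : H p (x - 1 - 1) (y + 2) = H p' (x' - 1 - 1) (y' + 2))
    (hmid : H p (x - 1) (y + 1) = H p' (x' - 1) (y' + 1)) (hleft : H p x y = H p' x' y') :
    H p x (y + 2) = H p' x' (y' + 2) :=
  hH.right (by omega) (by omega) (hH.right (by omega) (by omega) hup hmid)
    (hH.right hxy hxy' hmid hleft)

theorem diag_right (hH : IsTriangular H) (hup : H p (y - 1) (y + 1) = H p' (y' - 1) (y' + 1))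
    (hleft : H p y y = H p' y' y') : H p (y + 1) (y + 1) = H p' (y' + 1) (y' + 1) :=
  hH.right le_rfl le_rfl (hH.right (by omega) (by omega) hup hleft) (hH.diag hleft)

/-- After `k` steps, the cell of index `c` (counted from `0`) holds the value at `(k - c, k + c)`,
where the truncated subtraction stands for the letters that have not met a signal yet. -/
theorem mem_realTimeCA [Finite T] {H : List α → ℕ → ℕ → T} (hH : IsTriangular H)
    (letter : α ↪ T) (hletter : ∀ w y (h : y < w.length), H w 0 y = letter w[y]) (acc : Set T) :
    ({w | w ≠ [] ∧ H w (w.length - 1 + 1) (w.length - 1) ∈ acc} : Language α) ∈ RealTimeCA α := by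
  obtain ⟨accDiag, hacc⟩ : ∃ accDiag : Set T, ∀ w y, H w (y + 1) y ∈ acc ↔ H w y y ∈ accDiag :=
    ⟨{t | ∃ w y, H w y y = t ∧ H w (y + 1) y ∈ acc}, fun w y =>
      ⟨fun h => ⟨w, y, rfl, h⟩, fun ⟨_, _, heq, h⟩ => hH.diag heq ▸ h⟩⟩
  simp only [hacc]
  refine mem_realTimeCA_of_determined (st := fun w k c => H w (k - c) (k + c)) letter
    (fun w c h => ?_) (fun hm hr => hH.diag_right hr hm) (fun {w w' k k' c c'} hl hm hr => ?_) _
  · simpa only [Nat.zero_sub, zero_add] using hletter w c h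
  · rw [Nat.add_sub_add_right, Nat.add_sub_add_right, add_add_add_comm, add_add_add_comm k']
    exact hH.right_right (by omega) (by omega) hr hm hl

end IsTriangular

end CellularAutomaton

/-! ## Least fixed points of local operators -/

namespace PredHorn

/-- A monotone operator on the maps `ℕ → ℕ → V` that is local: its value at `(i, j)` depends on the
labels (of type `L`) of at most `radius` predecessors of `i` and of `j`, and on the argument at the
pairs of such predecessors, in both orders. Both properties are encoded in the field
`toFun_le_toFun`, which compares two labelings at two pairs of positions. Truncated subtraction
plays the role of `pred`. -/
structure LocalOperator (L V : Type*) [LE V] where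
  radius : ℕ
  toFun : (ℕ → L) → (ℕ → ℕ → V) → ℕ → ℕ → V
  toFun_le_toFun : ∀ {lab lab' : ℕ → L} {M M' : ℕ → ℕ → V} {i j i' j' : ℕ},
    (∀ a ≤ radius, lab (i - a) = lab' (i' - a)) → (∀ b ≤ radius, lab (j - b) = lab' (j' - b)) →
    (∀ a ≤ radius, ∀ b ≤ radius, M (i - a) (j - b) ≤ M' (i' - a) (j' - b)) →
    (∀ a ≤ radius, ∀ b ≤ radius, M (j - b) (i - a) ≤ M' (j' - b) (i' - a)) →
    toFun lab M i j ≤ toFun lab' M' i' j'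

namespace LocalOperator

section LeastFixedPoint

variable {L V : Type*} [CompleteLattice V] (F : LocalOperator L V) {lab lab' : ℕ → L}

theorem monotone (lab : ℕ → L) : Monotone (F.toFun lab) := fun _ _ h _ _ =>
  F.toFun_le_toFun (fun _ _ => rfl) (fun _ _ => rfl) (fun _ _ _ _ => h _ _) fun _ _ _ _ => h _ _

/-- The least fixed point of a local operator, on positions labeled by `lab`. -/
def lfp (lab : ℕ → L) : ℕ → ℕ → V :=
  OrderHom.lfp ⟨F.toFun lab, F.monotone lab⟩

theorem toFun_lfp (lab : ℕ → L) : F.toFun lab (F.lfp lab) = F.lfp lab :=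
  OrderHom.map_lfp ⟨F.toFun lab, F.monotone lab⟩

theorem lfp_le {M : ℕ → ℕ → V} (h : F.toFun lab M ≤ M) : F.lfp lab ≤ M :=
  OrderHom.lfp_le _ h

theorem toFun_le_lfp {M : ℕ → ℕ → V} (h : M ≤ F.lfp lab) : F.toFun lab M ≤ F.lfp lab :=
  (F.monotone lab h).trans (F.toFun_lfp lab).le

theorem lfp_le_of_forall_lt {N : ℕ} (h : ∀ p < N, lab p = lab' p) {i j : ℕ} (hi : i < N)
    (hj : j < N) : F.lfp lab i j ≤ F.lfp lab' i j := by
  suffices F.lfp lab ≤ fun i j => ⨅ (_ : i < N) (_ : j < N), F.lfp lab' i j from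
    (this i j).trans (iInf₂_le hi hj)
  refine F.lfp_le fun i j => le_iInf₂ fun hi hj => ?_
  refine (F.toFun_le_toFun (fun a _ => h _ (by omega)) (fun b _ => h _ (by omega))
    (fun a _ b _ => ?_) fun a _ b _ => ?_).trans (congrFun₂ (F.toFun_lfp lab') i j).le
  · exact iInf₂_le ((i.sub_le a).trans_lt hi) ((j.sub_le b).trans_lt hj)
  · exact iInf₂_le ((j.sub_le b).trans_lt hj) ((i.sub_le a).trans_lt hi)

theorem lfp_congr {N : ℕ} (h : ∀ p < N, lab p = lab' p) {i j : ℕ} (hi : i < N) (hj : j < N) :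
    F.lfp lab i j = F.lfp lab' i j :=
  (F.lfp_le_of_forall_lt h hi hj).antisymm (F.lfp_le_of_forall_lt (fun p hp => (h p hp).symm) hi hj)

/-- The values of `M` at `(i, j)` and at `(j, i)`. -/
def bothOrders (M : ℕ → ℕ → V) (i j : ℕ) : V × V := (M i j, M j i)

theorem bothOrders_lfp_le {x y x' y' : ℕ} (hx : ∀ a ≤ F.radius, lab (x - a) = lab' (x' - a))
    (hy : ∀ b ≤ F.radius, lab (y - b) = lab' (y' - b)) (hx₀ : x = 0 ↔ x' = 0)
    (hy₀ : y = 0 ↔ y' = 0)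
    (hle : ∀ a ≤ F.radius, ∀ b ≤ F.radius, ¬ (x - a = x ∧ y - b = y) →
      bothOrders (F.lfp lab) (x - a) (y - b) ≤ bothOrders (F.lfp lab') (x' - a) (y' - b)) :
    bothOrders (F.lfp lab) x y ≤ bothOrders (F.lfp lab') x' y' := by
  let M : ℕ → ℕ → V := fun i j => F.lfp lab i j ⊓
    ((⨅ _ : i = x ∧ j = y, F.lfp lab' x' y') ⊓ ⨅ _ : i = y ∧ j = x, F.lfp lab' y' x')
  have hM : bothOrders M x y ≤ bothOrders (F.lfp lab') x' y' :=
    ⟨inf_le_right.trans (inf_le_left.trans (iInf_le _ ⟨rfl, rfl⟩)),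
      inf_le_right.trans (inf_le_right.trans (iInf_le _ ⟨rfl, rfl⟩))⟩
  have hMwindow (a) (ha : a ≤ F.radius) (b) (hb : b ≤ F.radius) :
      bothOrders M (x - a) (y - b) ≤ bothOrders (F.lfp lab') (x' - a) (y' - b) := by
    by_cases hab : x - a = x ∧ y - b = y
    · rwa [hab.1, hab.2, show x' - a = x' by omega, show y' - b = y' by omega]
    · exact le_trans ⟨inf_le_left, inf_le_left⟩ (hle a ha b hb hab)
  -- Cutting the least fixed point down to the values of the other one leaves a prefixed point.
  have hprefixed : F.toFun lab M ≤ M := by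
    refine fun i j => le_inf (F.toFun_le_lfp (fun _ _ => inf_le_left) i j)
      (le_inf (le_iInf ?_) (le_iInf ?_))
    · rintro ⟨rfl, rfl⟩
      rw [← F.toFun_lfp lab']
      exact F.toFun_le_toFun hx hy (fun a ha b hb => (hMwindow a ha b hb).1)
        fun a ha b hb => (hMwindow a ha b hb).2
    · rintro ⟨rfl, rfl⟩
      rw [← F.toFun_lfp lab']
      exact F.toFun_le_toFun hy hx (fun b hb a ha => (hMwindow a ha b hb).2)
        fun b hb a ha => (hMwindow a ha b hb).1
  have hlfp : bothOrders (F.lfp lab) x y ≤ bothOrders M x y :=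
    ⟨F.lfp_le hprefixed x y, F.lfp_le hprefixed y x⟩
  exact hlfp.trans hM

/-- The finite type of what can be seen of a least fixed point within distance `F.radius` below a
pair of positions: the labels, and the values at the pairs of positions, in both orders. -/
abbrev View (F : LocalOperator L V) :=
  (Fin (F.radius + 1) → L × L) × (Fin (F.radius + 1) → Fin (F.radius + 1) → V × V)

/-- The view of the least fixed point on `lab` below `(x, y)`. -/
def view (lab : ℕ → L) (x y : ℕ) : F.View :=
  (fun a => (lab (x - a), lab (y - a)), fun a b => bothOrders (F.lfp lab) (x - a) (y - b))

theorem view_eq_iff {x y x' y' : ℕ} : F.view lab x y = F.view lab' x' y' ↔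
    (∀ a ≤ F.radius, lab (x - a) = lab' (x' - a)) ∧ (∀ b ≤ F.radius, lab (y - b) = lab' (y' - b)) ∧
    ∀ a ≤ F.radius, ∀ b ≤ F.radius,
      bothOrders (F.lfp lab) (x - a) (y - b) = bothOrders (F.lfp lab') (x' - a) (y' - b) := by
  simp only [view, Prod.mk.injEq, funext_iff, Fin.forall_iff, Nat.lt_succ_iff, forall_and,
    and_assoc]

theorem view_eq_of {x y x' y' : ℕ} (hx : ∀ a ≤ F.radius, lab (x - a) = lab' (x' - a))
    (hy : ∀ b ≤ F.radius, lab (y - b) = lab' (y' - b)) (hx₀ : x = 0 ↔ x' = 0)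
    (hy₀ : y = 0 ↔ y' = 0)
    (heq : ∀ a ≤ F.radius, ∀ b ≤ F.radius, ¬ (x - a = x ∧ y - b = y) →
      bothOrders (F.lfp lab) (x - a) (y - b) = bothOrders (F.lfp lab') (x' - a) (y' - b)) :
    F.view lab x y = F.view lab' x' y' := by
  refine F.view_eq_iff.2 ⟨hx, hy, fun a ha b hb => ?_⟩
  by_cases hab : x - a = x ∧ y - b = y
  · rw [hab.1, hab.2, show x' - a = x' by omega, show y' - b = y' by omega]
    refine (F.bothOrders_lfp_le hx hy hx₀ hy₀ fun a ha b hb hab => (heq a ha b hb hab).le).antisymm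
      (F.bothOrders_lfp_le (fun a ha => (hx a ha).symm) (fun b hb => (hy b hb).symm) hx₀.symm
        hy₀.symm fun a ha b hb hab => (heq a ha b hb (by omega)).ge)
  · exact heq a ha b hb hab

end LeastFixedPoint

end LocalOperator

/-- What the input predicates say about a position: its letter, if any, and whether `min` and `max`
hold there. -/
abbrev Label (α : Type*) := Option α × Prop × Prop

/-- The labels of the positions, counted from `0`, of `w`, where `max` holds at `n` if `μ = true`,
and nowhere otherwise. -/
def label (w : List α) (μ : Bool) (n p : ℕ) : Label α := (w[p]?, p = 0, μ = true ∧ p = n)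

theorem label_succ (w : List α) (μ : Bool) {n p : ℕ} (hp : p ≤ n) :
    label w μ (n + 1) p = label w false n p := by
  simp [label, show p ≠ n + 1 by omega]

theorem label_self_eq {w w' : List α} (μ : Bool) {n n' : ℕ} (h : w[n]? = w'[n']?)
    (h₀ : n = 0 ↔ n' = 0) : label w μ n n = label w' μ n' n' := by
  simp [label, h, h₀]

namespace LocalOperator

variable {V : Type*} [CompleteLattice V] (F : LocalOperator (Label α) V) {w w' : List α}
  {x' y' x y : ℕ}

/-- The view below `(x, y)` both when `y` is the last position of the word and when the word goes on
after `y`. -/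
def signature (w : List α) (x y : ℕ) (μ : Bool) : F.View :=
  F.view (label w μ y) x y

theorem bothOrders_lfp_label_succ (w : List α) (μ : Bool) {n i j : ℕ} (hi : i ≤ n) (hj : j ≤ n) :
    bothOrders (F.lfp (label w μ (n + 1))) i j = bothOrders (F.lfp (label w false n)) i j := by
  have hlfp (i j : ℕ) (hi : i ≤ n) (hj : j ≤ n) :=
    F.lfp_congr (fun p hp => label_succ w μ (Nat.lt_succ_iff.1 hp))
      (Nat.lt_succ_of_le hi) (Nat.lt_succ_of_le hj)
  rw [bothOrders, hlfp i j hi hj, hlfp j i hj hi, bothOrders]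

theorem signature_zero_zero (h : w[0]? = w'[0]?) : F.signature w 0 0 = F.signature w' 0 0 := by
  have hlabel (μ) (a) (_ : a ≤ F.radius) : label w μ 0 (0 - a) = label w' μ 0 (0 - a) := by
    simpa only [Nat.zero_sub] using label_self_eq μ h Iff.rfl
  exact funext fun μ => F.view_eq_of (hlabel μ) (hlabel μ) Iff.rfl Iff.rfl
    fun a _ b _ hab => absurd ⟨Nat.zero_sub a, Nat.zero_sub b⟩ hab

theorem signature_zero_succ (h : F.signature w 0 y = F.signature w' 0 y')
    (hl : w[y + 1]? = w'[y' + 1]?) : F.signature w 0 (y + 1) = F.signature w' 0 (y' + 1) := by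
  obtain ⟨hx, hy, hlfp⟩ := F.view_eq_iff.1 (congrFun h false)
  refine funext fun μ => F.view_eq_of (fun a ha => ?_) (fun b hb => ?_) Iff.rfl (by simp)
    fun a ha b hb hab => ?_
  · rw [label_succ w μ (by omega), label_succ w' μ (by omega), hx a ha]
  · cases b with
    | zero => exact label_self_eq μ hl (by simp)
    | succ b =>
      rw [Nat.add_sub_add_right, Nat.add_sub_add_right, label_succ w μ (by omega),
        label_succ w' μ (by omega), hy b (by omega)]
  · obtain ⟨b, rfl⟩ := Nat.exists_eq_succ_of_ne_zero (n := b) (by omega)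
    rw [Nat.add_sub_add_right, Nat.add_sub_add_right,
      F.bothOrders_lfp_label_succ w μ (by omega) (by omega),
      F.bothOrders_lfp_label_succ w' μ (by omega) (by omega), hlfp a ha b (by omega)]

theorem signature_succ_succ (hxy : x < y) (hxy' : x' < y')
    (hup : F.signature w x (y + 1) = F.signature w' x' (y' + 1))
    (hleft : F.signature w (x + 1) y = F.signature w' (x' + 1) y') :
    F.signature w (x + 1) (y + 1) = F.signature w' (x' + 1) (y' + 1) := by
  obtain ⟨hx, -, hlfpLeft⟩ := F.view_eq_iff.1 (congrFun hleft false)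
  refine funext fun μ => ?_
  obtain ⟨-, hy, hlfpUp⟩ := F.view_eq_iff.1 (congrFun hup μ)
  refine F.view_eq_of (fun a ha => ?_) hy (by simp) (by simp) fun a ha b hb hab => ?_
  · rw [label_succ w μ (by omega), label_succ w' μ (by omega), hx a ha]
  · cases a with
    | zero =>
      obtain ⟨b, rfl⟩ := Nat.exists_eq_succ_of_ne_zero (n := b) (by omega)
      rw [Nat.add_sub_add_right, Nat.add_sub_add_right,
        F.bothOrders_lfp_label_succ w μ (by omega) (by omega),
        F.bothOrders_lfp_label_succ w' μ (by omega) (by omega), hlfpLeft 0 ha b (by omega)]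
    | succ a =>
      rw [Nat.add_sub_add_right, Nat.add_sub_add_right, hlfpUp a (by omega) b hb]

theorem signature_succ_self (h : F.signature w y (y + 1) = F.signature w' y' (y' + 1)) :
    F.signature w (y + 1) (y + 1) = F.signature w' (y' + 1) (y' + 1) := by
  refine funext fun μ => ?_
  obtain ⟨-, hy, hlfp⟩ := F.view_eq_iff.1 (congrFun h μ)
  refine F.view_eq_of hy hy (by simp) (by simp) fun a ha b hb hab => ?_
  cases a with
  | zero =>
    obtain ⟨b, rfl⟩ := Nat.exists_eq_succ_of_ne_zero (n := b) (by omega)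
    rw [Nat.add_sub_add_right, Nat.add_sub_add_right]
    exact congrArg Prod.swap (hlfp b (by omega) 0 ha)
  | succ a =>
    rw [Nat.add_sub_add_right, Nat.add_sub_add_right, hlfp a (by omega) b hb]

/-- The signatures, with the letters of the word in an additional first row. -/
def triangle (w : List α) : ℕ → ℕ → Option α ⊕ (Bool → F.View)
  | 0, y => .inl w[y]?
  | x + 1, y => .inr (F.signature w x y)

theorem isTriangular_triangle : CellularAutomaton.IsTriangular F.triangle where
  zero_iff {_ _ x x' _ _} h := by
    cases x <;> cases x' <;> simp [triangle] at h ⊢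
  diag {w w' y y'} h := by
    match y, y', h with
    | 0, 0, h => exact congrArg Sum.inr (F.signature_zero_zero (Sum.inl.inj h))
    | y + 1, y' + 1, h => exact congrArg Sum.inr (F.signature_succ_self (Sum.inr.inj h))
  inner {w w' x x' y y'} hxy hxy' hup hleft := by
    match x, x', hup with
    | 0, 0, hup =>
      exact congrArg Sum.inr (F.signature_zero_succ (Sum.inr.inj hleft) (Sum.inl.inj hup))
    | x + 1, x' + 1, hup =>
      exact congrArg Sum.inr (F.signature_succ_succ (by omega) (by omega) (Sum.inr.inj hup)
        (Sum.inr.inj hleft))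

theorem mem_realTimeCA [Finite α] [Finite V] (acc : Set V) :
    ({w | w ≠ [] ∧ F.lfp (label w true (w.length - 1)) (w.length - 1) (w.length - 1) ∈ acc} :
      Language α) ∈ RealTimeCA α := by
  have := F.isTriangular_triangle.mem_realTimeCA (Function.Embedding.some.trans .inl)
    (fun w y h => congrArg Sum.inl (List.getElem?_eq_getElem h))
    {t | ∃ s, t = .inr s ∧ ((s true).2 0 0).1 ∈ acc}
  simpa [triangle, signature, view, bothOrders] using this

end LocalOperator

/-! ## From formulas to automata -/

variable {α : Type*} {ρ : Type}

/-- `Var.value` over `ℕ`. -/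
def Var.natValue (i j : ℕ) : Var → ℕ
  | .x => i
  | .y => j

/-- `Extremum.Holds` for a labeled position. -/
def Extremum.Eval (l : Label α) : Extremum → Prop
  | .min => l.2.1
  | .max => l.2.2

/-- `Hypothesis.Holds` over `ℕ`, where `M i j` is the set of the predicates that hold at `(i, j)`,
and `none` stands for falsity. -/
def Hypothesis.Eval (lab : ℕ → Label α) (M : ℕ → ℕ → Set (Option ρ)) (i j : ℕ) :
    Hypothesis α ρ → Prop
  | .letter s v a => (lab (v.natValue i j - a)).1 = some s
  | .pos U v a => U.Eval (lab (v.natValue i j - a))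
  | .neg U v a => ¬ U.Eval (lab (v.natValue i j - a))
  | .compXY S a b => some S ∈ M (i - a) (j - b)
  | .compYX S b a => some S ∈ M (j - b) (i - a)

/-- A bound on the number of predecessors taken by the terms of a hypothesis. -/
def Hypothesis.offset : Hypothesis α ρ → ℕ
  | .letter _ _ a | .pos _ _ a | .neg _ _ a => a
  | .compXY _ a b | .compYX _ b a => a + b

theorem Hypothesis.Eval.transfer {D : ℕ} {lab lab' : ℕ → Label α}
    {M M' : ℕ → ℕ → Set (Option ρ)} {i j i' j' : ℕ} {h : Hypothesis α ρ} (hD : h.offset ≤ D)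
    (hi : ∀ a ≤ D, lab (i - a) = lab' (i' - a)) (hj : ∀ b ≤ D, lab (j - b) = lab' (j' - b))
    (hxy : ∀ a ≤ D, ∀ b ≤ D, M (i - a) (j - b) ≤ M' (i' - a) (j' - b))
    (hyx : ∀ a ≤ D, ∀ b ≤ D, M (j - b) (i - a) ≤ M' (j' - b) (i' - a))
    (H : h.Eval lab M i j) : h.Eval lab' M' i' j' := by
  have hlab (v : Var) (a) (ha : a ≤ D) :
      lab (v.natValue i j - a) = lab' (v.natValue i' j' - a) := by
    cases v
    exacts [hi a ha, hj a ha]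
  cases h with
  | letter s v a => rwa [Eval, hlab v a hD] at H
  | pos U v a => rwa [Eval, hlab v a hD] at H
  | neg U v a => rwa [Eval, hlab v a hD] at H
  | compXY S a b => exact hxy a (le_of_add_le_left hD) b (le_of_add_le_right hD) H
  | compYX S b a => exact hyx a (le_of_add_le_left hD) b (le_of_add_le_right hD) H

namespace Formula

variable (Φ : Formula α)

/-- A bound on the offsets in a formula, which is positive to allow for the propagation of falsity
in `consequence`. -/
def radius : ℕ := ((Φ.clauses.flatMap Clause.hyps).map Hypothesis.offset).sum + 1

theorem offset_le_radius {C : Clause α Φ.ρ} (hC : C ∈ Φ.clauses) {h : Hypothesis α Φ.ρ}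
    (hh : h ∈ C.hyps) : h.offset ≤ Φ.radius :=
  Nat.le_succ_of_le <| List.le_sum_of_mem <| List.mem_map_of_mem <| List.mem_flatMap_of_mem hC hh

/-- The immediate consequences of the clauses of a formula, where `none` stands for falsity. So that
a contradiction found anywhere reaches the last pair of positions, falsity moreover propagates to
the successors of each of the two positions. -/
def consequence : LocalOperator (Label α) (Set (Option Φ.ρ)) where
  radius := Φ.radius
  toFun lab M i j := {S | (∃ C ∈ Φ.clauses, C.concl = S ∧ ∀ h ∈ C.hyps, h.Eval lab M i j) ∨
    S = none ∧ (none ∈ M (i - 1) j ∨ none ∈ M i (j - 1))}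
  toFun_le_toFun hi hj hxy hyx S := by
    have hradius : 1 ≤ Φ.radius := Nat.le_add_left 1 _
    rintro (⟨C, hC, hS, hhyps⟩ | ⟨hS, hfalse⟩)
    · exact Or.inl ⟨C, hC, hS, fun h hh =>
        (hhyps h hh).transfer (Φ.offset_le_radius hC hh) hi hj hxy hyx⟩
    · exact Or.inr ⟨hS, hfalse.imp (fun h => hxy 1 hradius 0 zero_le h)
        fun h => hxy 0 zero_le 1 hradius h⟩

variable {Φ} {lab : ℕ → Label α}

theorem concl_mem_lfp {C : Clause α Φ.ρ} (hC : C ∈ Φ.clauses) {i j : ℕ}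
    (hhyps : ∀ h ∈ C.hyps, h.Eval lab (Φ.consequence.lfp lab) i j) :
    C.concl ∈ Φ.consequence.lfp lab i j := by
  rw [← Φ.consequence.toFun_lfp]
  exact Or.inl ⟨C, hC, rfl, hhyps⟩

theorem none_mem_lfp_of_le {i j i' j' : ℕ} (hi : i ≤ i') (hj : j ≤ j')
    (h : none ∈ Φ.consequence.lfp lab i j) : none ∈ Φ.consequence.lfp lab i' j' := by
  have hstep {i j : ℕ} (h : none ∈ Φ.consequence.lfp lab (i - 1) j ∨
      none ∈ Φ.consequence.lfp lab i (j - 1)) : none ∈ Φ.consequence.lfp lab i j := by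
    rw [← Φ.consequence.toFun_lfp]
    exact Or.inr ⟨rfl, h⟩
  have hright : none ∈ Φ.consequence.lfp lab i' j := by
    induction i', hi using Nat.le_induction with
    | base => exact h
    | succ i' _ ih => exact hstep (Or.inl ih)
  induction j', hj using Nat.le_induction with
  | base => exact hright
  | succ j' _ ih => exact hstep (Or.inr ih)

end Formula

theorem val_iterate_pred {n : ℕ} (a : ℕ) (i : Fin n) : (pred^[a] i).val = i.val - a := by
  induction a with
  | zero => rfl
  | succ a ih => simp only [Function.iterate_succ_apply', pred, ih, Nat.sub_sub]

theorem Hypothesis.eval_iff_holds {w : List α} {M : ℕ → ℕ → Set (Option ρ)}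
    {R : ρ → Fin w.length → Fin w.length → Prop}
    (hM : ∀ S (i j : Fin w.length), some S ∈ M i j ↔ R S i j) (i j : Fin w.length)
    (h : Hypothesis α ρ) :
    h.Eval (label w true (w.length - 1)) M i j ↔ h.Holds w R i j := by
  have hvalue (v : Var) (a : ℕ) : v.natValue i j - a = (pred^[a] (v.value i j)).val := by
    rw [val_iterate_pred]
    cases v <;> rfl
  have hextremum (U : Extremum) (p : Fin w.length) :
      U.Eval (label w true (w.length - 1) p) ↔ U.Holds p := by
    cases U <;> simp only [Extremum.Eval, Extremum.Holds, label, true_and] <;> omega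
  cases h with
  | letter s v a => simp [Eval, Holds, hvalue, label]
  | pos U v a => simp only [Eval, Holds, hvalue, hextremum]
  | neg U v a => simp only [Eval, Holds, hvalue, hextremum]
  | compXY S a b => simp only [Eval, Holds, ← val_iterate_pred, hM]
  | compYX S b a => simp only [Eval, Holds, ← val_iterate_pred, hM]

namespace Formula

variable {Φ : Formula α} {w : List α}

theorem Sat.none_notMem_lfp (h : Φ.Sat w) {i j : ℕ} (hi : i < w.length) (hj : j < w.length) :
    none ∉ Φ.consequence.lfp (label w true (w.length - 1)) i j := by
  obtain ⟨R, hR⟩ := h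
  let M (i j : ℕ) : Set (Option Φ.ρ) :=
    {S | ∀ (hi : i < w.length) (hj : j < w.length), S.elim False fun S => R S ⟨i, hi⟩ ⟨j, hj⟩}
  suffices hM : Φ.consequence.toFun (label w true (w.length - 1)) M ≤ M from
    fun hnone => Φ.consequence.lfp_le hM i j hnone hi hj
  rintro i j _ (⟨C, hC, rfl, hhyps⟩ | ⟨rfl, hnone | hnone⟩) hi hj
  · have hconcl := hR ⟨i, hi⟩ ⟨j, hj⟩ C hC fun h hh => (h.eval_iff_holds (M := M)
      (fun S i j => ⟨fun H => H i.2 j.2, fun H _ _ => H⟩) ⟨i, hi⟩ ⟨j, hj⟩).1 (hhyps h hh)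
    cases hC' : C.concl <;> simp_all
  · exact hnone ((i.sub_le 1).trans_lt hi) hj
  · exact hnone hi ((j.sub_le 1).trans_lt hj)

theorem sat_of_none_notMem_lfp (h : none ∉ Φ.consequence.lfp (label w true (w.length - 1))
    (w.length - 1) (w.length - 1)) : Φ.Sat w := by
  refine ⟨fun S i j => some S ∈ Φ.consequence.lfp (label w true (w.length - 1)) i j,
    fun i j C hC hhyps => ?_⟩
  have hconcl := concl_mem_lfp hC fun h hh =>
    (h.eval_iff_holds (fun _ _ _ => Iff.rfl) i j).2 (hhyps h hh)
  cases hC' : C.concl with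
  | none => exact h (none_mem_lfp_of_le (by omega) (by omega) (hC' ▸ hconcl))
  | some S => rwa [hC'] at hconcl

end Formula

theorem predESOHorn_subset_realTimeCA [Finite α] : PredESOHorn α ⊆ RealTimeCA α := by
  rintro _ ⟨Φ, rfl⟩
  have := Φ.finite_ρ
  obtain ⟨A, hA⟩ := Φ.consequence.mem_realTimeCA {M | none ∉ M}
  refine ⟨A, hA.trans (Set.ext fun w => and_congr_right fun hw => ?_)⟩
  have hlast : w.length - 1 < w.length := Nat.sub_one_lt (List.length_pos_iff.2 hw).ne'
  exact ⟨Formula.sat_of_none_notMem_lfp, fun h => h.none_notMem_lfp hlast hlast⟩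

/-! ## From automata to formulas -/

theorem mem_predESOHorn_of_finite {ρ : Type} [Finite ρ] {ι : Type*} [Finite ι]
    (C : ι → Clause α ρ) :
    ({w | w ≠ [] ∧ ∃ R : ρ → Fin w.length → Fin w.length → Prop,
      ∀ i j k, (C k).Holds w R i j} : Language α) ∈ PredESOHorn α := by
  refine ⟨⟨ρ, inferInstance, (Set.finite_range C).toFinset.toList⟩, ?_⟩
  exact Set.ext fun w => by simp [Formula.language, Formula.Sat]

end PredHorn

namespace CellularAutomaton

open PredHorn

/-- The computation predicates of the formula that describes an automaton with set of states `Q`: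
`x = y`, `x < y`, and one predicate for each state. -/
inductive Predicate (Q : Type)
  | eq
  | lt
  | state (q : Q)

instance {Q : Type} [Finite Q] : Finite (Predicate Q) :=
  Finite.of_injective (β := Option (Option Q))
    (fun | .eq => none | .lt => some none | .state q => some (some q))
    (by rintro (_ | _ | q) (_ | _ | q') h <;> simp_all)

variable {α : Type*} (A : CellularAutomaton α {-1, 0, 1})

/-- The index set of the clauses `Rule.clause`. -/
inductive Rule
  | eqMin
  | eqSucc
  | ltOfEq
  | ltOfLt
  | input (s : α)
  | firstCell (m r : A.Q)
  | innerCell (l m r : A.Q)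
  | reject (q : A.Q) (hq : q ∉ A.accept)

instance : Finite A.Rule := by
  have := A.finite_Q
  have : Finite α := Finite.of_injective A.letter A.letter.injective
  refine Finite.of_injective (β := Fin 4 ⊕ α ⊕ (A.Q × A.Q) ⊕ (A.Q × A.Q × A.Q) ⊕ A.Q) (fun
    | .eqMin => .inl 0
    | .eqSucc => .inl 1
    | .ltOfEq => .inl 2
    | .ltOfLt => .inl 3
    | .input s => .inr (.inl s)
    | .firstCell m r => .inr (.inr (.inl (m, r)))
    | .innerCell l m r => .inr (.inr (.inr (.inl (l, m, r))))
    | .reject q _ => .inr (.inr (.inr (.inr q)))) ?_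
  rintro (_ | _ | _ | _ | _ | _ | _ | _) (_ | _ | _ | _ | _ | _ | _ | _) h <;> simp_all

/-- The transition function as a function of the states of the left, middle and right cells. -/
def next (l m r : A.Q) : A.Q :=
  A.δ fun v _ => if v = -1 then l else if v = 0 then m else r

theorem stateAfter_succ {w : List α} (k : ℕ) {c : ℤ} (hc : 1 ≤ c ∧ c ≤ (w.length : ℤ)) :
    A.stateAfter w (k + 1) c =
      A.next (A.stateAfter w k (c - 1)) (A.stateAfter w k c) (A.stateAfter w k (c + 1)) := by
  rw [stateAfter, if_pos hc, next]
  congr 1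
  funext v hv
  simp only [Finset.mem_insert, Finset.mem_singleton] at hv
  rcases hv with rfl | rfl | rfl <;> simp [sub_eq_add_neg]

/-- The state of the cell of index `j - i`, counted from `0`, after `i` steps. In these coordinates
the state at `(i, j)` is computed from those at `(i - 1, j - 2)`, `(i - 1, j - 1)` and `(i - 1, j)`,
which are reached by predecessors only, and the output is at the last pair of positions. -/
def site (w : List α) (i j : ℕ) : A.Q :=
  A.stateAfter w i ((j : ℤ) - i + 1)

variable {A} {w : List α}

/-- The clauses that describe the automaton: they define the predicates `=` and `<`, compute the
states `A.site w x y` for `x ≤ y`, and exclude the rejecting states at the output. The first cell is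
at the pairs with `x = y`. -/
def Rule.clause : A.Rule → Clause α (Predicate A.Q)
  | .eqMin => ⟨[.pos .min .x 0, .pos .min .y 0], some .eq⟩
  | .eqSucc => ⟨[.neg .min .x 0, .neg .min .y 0, .compXY .eq 1 1], some .eq⟩
  | .ltOfEq => ⟨[.neg .min .y 0, .compXY .eq 0 1], some .lt⟩
  | .ltOfLt => ⟨[.neg .min .y 0, .compXY .lt 0 1], some .lt⟩
  | .input s => ⟨[.pos .min .x 0, .letter s .y 0], some (.state (A.letter s))⟩
  | .firstCell m r => ⟨[.neg .min .x 0, .compXY .eq 0 0, .compXY (.state m) 1 1,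
      .compXY (.state r) 1 0], some (.state (A.next A.sharp m r))⟩
  | .innerCell l m r => ⟨[.neg .min .x 0, .compXY .lt 0 0, .compXY (.state l) 1 2,
      .compXY (.state m) 1 1, .compXY (.state r) 1 0], some (.state (A.next l m r))⟩
  | .reject q _ => ⟨[.pos .max .x 0, .pos .max .y 0, .compXY (.state q) 0 0], none⟩

theorem site_zero {j : ℕ} (hj : j < w.length) : A.site w 0 j = A.letter w[j] := by
  rw [site, stateAfter, dif_pos (by omega)]
  simp

theorem site_succ_self {i : ℕ} (hi : i + 1 < w.length) :
    A.site w (i + 1) (i + 1) = A.next A.sharp (A.site w i i) (A.site w i (i + 1)) := by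
  rw [site, A.stateAfter_succ i (by omega), ← A.stateAfter_zero_left w i, site, site]
  congr 2 <;> push_cast <;> ring

theorem site_succ_add_two {i j : ℕ} (hij : i ≤ j) (hj : j + 2 < w.length) :
    A.site w (i + 1) (j + 2) =
      A.next (A.site w i j) (A.site w i (j + 1)) (A.site w i (j + 2)) := by
  rw [site, A.stateAfter_succ i (by omega), site, site, site]
  congr 2 <;> push_cast <;> ring

theorem site_self (i : ℕ) : A.site w i i = A.stateAfter w i 1 := by
  rw [site, sub_self, zero_add]

variable (A w) in
/-- The intended interpretation of the computation predicates. -/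
def interp : Predicate A.Q → Fin w.length → Fin w.length → Prop
  | .eq, i, j => i.val = j.val
  | .lt, i, j => i.val < j.val
  | .state q, i, j => i.val ≤ j.val ∧ A.site w i j = q

theorem Rule.holds_interp (h : A.stateAfter w (w.length - 1) 1 ∈ A.accept) (r : A.Rule)
    (i j : Fin w.length) : r.clause.Holds w (A.interp w) i j := by
  obtain ⟨i, hi⟩ := i
  obtain ⟨j, hj⟩ := j
  cases r <;>
    simp only [clause, Clause.Holds, List.forall_mem_cons, List.not_mem_nil, false_imp_iff,
      implies_true, and_true, Hypothesis.Holds, Extremum.Holds, Var.value, Function.iterate_zero,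
      id, Function.iterate_succ, Function.comp, interp, pred, and_imp]
  case eqMin | eqSucc | ltOfEq | ltOfLt => omega
  case input s =>
    intro hi₀ hs
    obtain rfl : i = 0 := by omega
    exact ⟨zero_le, (site_zero hj).trans (congrArg A.letter hs)⟩
  case firstCell m r =>
    rintro hi₀ rfl - rfl - rfl
    obtain ⟨i, rfl⟩ := Nat.exists_eq_succ_of_ne_zero (n := i) (by omega)
    exact ⟨le_rfl, site_succ_self hi⟩
  case innerCell l m r =>
    rintro hi₀ hlt - rfl - rfl - rfl
    obtain ⟨i, rfl⟩ := Nat.exists_eq_succ_of_ne_zero (n := i) (by omega)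
    obtain ⟨j, rfl⟩ := Nat.exists_eq_add_of_le' (show 2 ≤ j by omega)
    exact ⟨hlt.le, site_succ_add_two (by omega) hj⟩
  case reject q hq =>
    rintro hi' hj' - rfl
    obtain rfl : i = w.length - 1 := by omega
    obtain rfl : j = w.length - 1 := by omega
    exact hq (site_self _ ▸ h)

section Closed

variable {R : Predicate A.Q → Fin w.length → Fin w.length → Prop}
  (hR : ∀ i j (r : A.Rule), r.clause.Holds w R i j)

include hR

theorem eq_of_holds {i : ℕ} (hi : i < w.length) : R .eq ⟨i, hi⟩ ⟨i, hi⟩ := by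
  induction i with
  | zero =>
    refine hR ⟨0, hi⟩ ⟨0, hi⟩ .eqMin ?_
    simp [Rule.clause, Hypothesis.Holds, Extremum.Holds, Var.value]
  | succ i ih =>
    refine hR ⟨i + 1, hi⟩ ⟨i + 1, hi⟩ .eqSucc ?_
    simpa [Rule.clause, Hypothesis.Holds, Extremum.Holds, Var.value, pred] using ih (by omega)

theorem lt_of_holds {i j : ℕ} (hi : i < w.length) (hj : j < w.length) (hij : i + 1 ≤ j) :
    R .lt ⟨i, hi⟩ ⟨j, hj⟩ := by
  induction j, hij using Nat.le_induction with
  | base =>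
    refine hR ⟨i, hi⟩ ⟨i + 1, hj⟩ .ltOfEq ?_
    simpa [Rule.clause, Hypothesis.Holds, Extremum.Holds, Var.value, pred] using
      eq_of_holds hR hi
  | succ j _ ih =>
    refine hR ⟨i, hi⟩ ⟨j + 1, hj⟩ .ltOfLt ?_
    simpa [Rule.clause, Hypothesis.Holds, Extremum.Holds, Var.value, pred] using ih (by omega)

theorem state_of_holds {i j : ℕ} (hi : i < w.length) (hj : j < w.length) (hij : i ≤ j) :
    R (.state (A.site w i j)) ⟨i, hi⟩ ⟨j, hj⟩ := by
  induction i generalizing j with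
  | zero =>
    rw [site_zero hj]
    refine hR ⟨0, hi⟩ ⟨j, hj⟩ (.input w[j]) ?_
    simp [Rule.clause, Hypothesis.Holds, Extremum.Holds, Var.value]
  | succ i ih =>
    rcases hij.eq_or_lt with rfl | hlt
    · rw [site_succ_self hi]
      refine hR ⟨i + 1, hi⟩ ⟨i + 1, hi⟩ (.firstCell _ _) ?_
      simpa [Rule.clause, Hypothesis.Holds, Extremum.Holds, Var.value, pred] using
        ⟨eq_of_holds hR hi, ih (j := i) (by omega) (by omega) le_rfl,
          ih (j := i + 1) (by omega) hi (by omega)⟩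
    · obtain ⟨j, rfl⟩ := Nat.exists_eq_add_of_le' (show 2 ≤ j by omega)
      rw [site_succ_add_two (by omega) hj]
      refine hR ⟨i + 1, hi⟩ ⟨j + 2, hj⟩ (.innerCell _ _ _) ?_
      simpa [Rule.clause, Hypothesis.Holds, Extremum.Holds, Var.value, pred] using
        ⟨lt_of_holds hR hi hj hlt, ih (j := j) (by omega) (by omega) (by omega),
          ih (j := j + 1) (by omega) (by omega) (by omega),
          ih (j := j + 2) (by omega) hj (by omega)⟩

theorem accept_of_holds (hw : w ≠ []) : A.stateAfter w (w.length - 1) 1 ∈ A.accept := by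
  have hpos := List.length_pos_iff.2 hw
  have hlast : w.length - 1 < w.length := Nat.sub_one_lt hpos.ne'
  have houtput := state_of_holds hR hlast hlast le_rfl
  rw [site_self] at houtput
  by_contra hreject
  refine hR ⟨_, hlast⟩ ⟨_, hlast⟩ (.reject _ hreject) ?_
  simpa [Rule.clause, Hypothesis.Holds, Extremum.Holds, Var.value, Nat.sub_add_cancel hpos] using
    houtput

end Closed

theorem realTimeCA_subset_predESOHorn : RealTimeCA α ⊆ PredESOHorn α := by
  rintro _ ⟨A, rfl⟩
  have := A.finite_Q
  obtain ⟨Φ, hΦ⟩ := mem_predESOHorn_of_finite (Rule.clause (A := A))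
  refine ⟨Φ, hΦ.trans (Set.ext fun w => and_congr_right fun hw => ?_)⟩
  exact ⟨fun ⟨_, hR⟩ => accept_of_holds hR hw,
    fun h => ⟨A.interp w, fun i j r => r.holds_interp h i j⟩⟩

end CellularAutomaton

theorem mainTheorem1 (α : Type*) [Finite α] : RealTimeCA α = PredESOHorn α :=
  Set.Subset.antisymm CellularAutomaton.realTimeCA_subset_predESOHorn
    PredHorn.predESOHorn_subset_realTimeCA
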